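/- All topological groups, including continuous homomorphic images, are assumed to be Hausdorff. Completeness of a topological group, and Cauchy sequences in it, refer to its two-sided uniformity (the coarsest uniformity finer than both the left and the right uniformity); a topological group is sequentially complete if every Cauchy sequence in it converges. A topological group is $h$-complete (respectively, sequentially $h$-complete) if all its continuous homomorphic images are complete (respectively, sequentially complete). A topological group is maximally almost periodic (MAP) if it admits a continuous injective homomorphism into a compact group. Theorem. Let $G$ be a complete topological group. Then the following assertions are equivalent: (i) for every closed separable subgroup $H$ of $G$, every closed normal subgroup $N$ of $H$ is $h$-complete and MAP; (ii) every closed separable subgroup $H$ of $G$ is sequentially $h$-complete, and every metrizable quotient $H/N$ of $H$ by a normal subgroup $N$ (which is then automatically closed in $H$) is MAP; (iii) $G$ is compact. -/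

import Mathlib

open Filter Topology

universe u

noncomputable section

/-- The two-sided uniformity of a topological group, that is, the coarsest uniformity finer than
both the left and the right uniformity. It induces the given topology. -/
abbrev twoSidedUniformSpace (G : Type u) [Group G] [TopologicalSpace G] [IsTopologicalGroup G] :
    UniformSpace G :=
  (IsTopologicalGroup.leftUniformSpace G ⊓ IsTopologicalGroup.rightUniformSpace G).replaceTopology
    (by
      rw [UniformSpace.toTopologicalSpace_inf]
      exact (inf_idem _).symm)

/-- A topological group is complete if it is complete in its two-sided uniformity. -/
def IsCompleteGroup (G : Type u) [Group G] [TopologicalSpace G] [IsTopologicalGroup G] : Prop :=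
  @CompleteSpace G (twoSidedUniformSpace G)

/-- A topological group is sequentially complete if every sequence that is Cauchy in the two-sided
uniformity converges. -/
def IsSeqCompleteGroup (G : Type u) [Group G] [TopologicalSpace G] [IsTopologicalGroup G] : Prop :=
  ∀ s : ℕ → G, @CauchySeq G ℕ (twoSidedUniformSpace G) _ s → ∃ x : G, Tendsto s atTop (𝓝 x)

/-- A topological group is `h`-complete if all its (Hausdorff) continuous homomorphic images are
complete. Every such image of `G : Type u` is isomorphic to one in `Type u`. -/
def IsHComplete (G : Type u) [Group G] [TopologicalSpace G] [IsTopologicalGroup G] : Prop :=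
  ∀ (K : Type u) [Group K] [TopologicalSpace K] [IsTopologicalGroup K] [T2Space K] (f : G →* K),
    Continuous f → Function.Surjective f → IsCompleteGroup K

/-- A topological group is sequentially `h`-complete if all its (Hausdorff) continuous homomorphic
images are sequentially complete. -/
def IsSeqHComplete (G : Type u) [Group G] [TopologicalSpace G] [IsTopologicalGroup G] : Prop :=
  ∀ (K : Type u) [Group K] [TopologicalSpace K] [IsTopologicalGroup K] [T2Space K] (f : G →* K),
    Continuous f → Function.Surjective f → IsSeqCompleteGroup K

/-- A topological group is maximally almost periodic (MAP) if it admits a continuous injective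
homomorphism into a compact Hausdorff group. (The universe is no restriction: one may pass to the
group of points of the Bohr compactification, that is, to the closure of the image of `G` in a
product, indexed by a set in `Type u`, of finite-dimensional unitary groups.) -/
def IsMAP (G : Type u) [Group G] [TopologicalSpace G] [IsTopologicalGroup G] : Prop :=
  ∃ (K : Type u) (_ : Group K) (_ : TopologicalSpace K) (_ : IsTopologicalGroup K)
    (_ : CompactSpace K) (_ : T2Space K) (m : G →* K), Continuous m ∧ Function.Injective m

end

/-!
A complete group is compact as soon as it is precompact, and precompactness is detected on closed
separable subgroups `H`, because its failure is witnessed by a sequence. The substance is therefore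
that a separable sequentially `h`-complete group `H` all of whose metrizable quotients are maximally
almost periodic is precompact (`IsSeqHComplete.isPrecompactGroup`).

A separable group has enough homomorphisms onto Hausdorff second countable groups `K` to determine
its neighbourhoods of the identity (`exists_monoidHom_secondCountable`), so it suffices that each
such `K` is compact. As `K` is an image of `H`, it is sequentially complete, hence Polish. The open
mapping theorem for Polish groups (`MonoidHom.isOpenMap_of_polishSpace`), applied to the projection
to `K` of the images of `H` in products `K × Q`, shows that `H → K` is open
(`IsSeqHComplete.isOpenMap`). So `K` is a metrizable quotient of `H`, and injects into a compact
group. Since `K` is second countable, countably many neighbourhoods of the identity in the compact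
group separate its elements from the identity, which yields a bijection of `K` onto a second
countable precompact group. The latter is complete, hence compact, and the bijection is open, so `K`
is compact (`IsSeqHComplete.compactSpace_of_isMAP`).

If closed normal subgroups of `H`, including `H` itself, are `h`-complete and maximally almost
periodic, an injection of `H` into a compact group maps all of them onto closed subgroups, and its
passage to quotients shows that every Hausdorff quotient of `H` is maximally almost periodic
(`IsHComplete.isMAP_quotient`).
-/

open TopologicalSpace

theorem exists_isOpen_one_inv_mul {G : Type*} [Group G] [TopologicalSpace G]
    [IsTopologicalGroup G] {U : Set G} (hU : U ∈ 𝓝 (1 : G)) :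
    ∃ V : Set G, IsOpen V ∧ (1 : G) ∈ V ∧ ∀ v ∈ V, ∀ w ∈ V, v⁻¹ * w ∈ U := by
  have h : (fun p : G × G => p.1⁻¹ * p.2) ⁻¹' U ∈ 𝓝 ((1 : G), (1 : G)) :=
    ContinuousAt.preimage_mem_nhds (by fun_prop) (by simpa using hU)
  rw [nhds_prod_eq, mem_prod_same_iff] at h
  obtain ⟨t, ht, htU⟩ := h
  obtain ⟨V, hVt, hV, h1⟩ := mem_nhds_iff.1 ht
  exact ⟨V, hV, h1, fun v hv w hw => htU (Set.mk_mem_prod (hVt hv) (hVt hw))⟩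

/-! ### Completeness in the two-sided uniformity -/

section Completeness

variable {G : Type u} [Group G] [TopologicalSpace G] [IsTopologicalGroup G]

theorem twoSidedUniformSpace_uniformity (G : Type u) [Group G] [TopologicalSpace G]
    [IsTopologicalGroup G] :
    @uniformity G (twoSidedUniformSpace G) =
      comap (fun p : G × G => p.1⁻¹ * p.2) (𝓝 1) ⊓ comap (fun p : G × G => p.2 * p.1⁻¹) (𝓝 1) :=
  rfl

theorem isCountablyGenerated_twoSidedUniformSpace [FirstCountableTopology G] :
    (@uniformity G (twoSidedUniformSpace G)).IsCountablyGenerated := by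
  rw [twoSidedUniformSpace_uniformity]
  infer_instance

theorem IsCompleteGroup.isSeqCompleteGroup (h : IsCompleteGroup G) : IsSeqCompleteGroup G := by
  intro s hs
  let _ : UniformSpace G := twoSidedUniformSpace G
  have : CompleteSpace G := h
  exact cauchySeq_tendsto_of_complete hs

theorem IsSeqCompleteGroup.isCompleteGroup [FirstCountableTopology G]
    (h : IsSeqCompleteGroup G) : IsCompleteGroup G := by
  let _ : UniformSpace G := twoSidedUniformSpace G
  have : (uniformity G).IsCountablyGenerated := isCountablyGenerated_twoSidedUniformSpace
  exact UniformSpace.complete_of_cauchySeq_tendsto h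

theorem isCompleteGroup_of_compactSpace [CompactSpace G] : IsCompleteGroup G := by
  let _ : UniformSpace G := twoSidedUniformSpace G
  exact inferInstanceAs (CompleteSpace G)

theorem IsSeqCompleteGroup.polishSpace [T2Space G] [SecondCountableTopology G]
    (h : IsSeqCompleteGroup G) : PolishSpace G := by
  have hc : IsCompleteGroup G := h.isCompleteGroup
  let _ : UniformSpace G := twoSidedUniformSpace G
  have : (uniformity G).IsCountablyGenerated := isCountablyGenerated_twoSidedUniformSpace
  have : CompleteSpace G := hc
  infer_instance

/-- The two-sided uniformity of a subgroup is induced by that of the group, so that a complete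
subgroup is a complete subset. -/
theorem Subgroup.isClosed_of_isCompleteGroup [T2Space G] (L : Subgroup G)
    (h : IsCompleteGroup L) : IsClosed (L : Set G) := by
  let uG : UniformSpace G := twoSidedUniformSpace G
  let uL : UniformSpace L := twoSidedUniformSpace L
  have : CompleteSpace L := h
  have hu : IsUniformInducing (Subtype.val : L → G) := by
    refine ⟨?_⟩
    have h1 : 𝓝 (1 : L) = Filter.comap Subtype.val (𝓝 (1 : G)) := nhds_induced _ _
    rw [twoSidedUniformSpace_uniformity, twoSidedUniformSpace_uniformity, h1, Filter.comap_inf,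
      Filter.comap_comap, Filter.comap_comap, Filter.comap_comap, Filter.comap_comap]
    rfl
  have := hu.isComplete_range.isClosed
  rwa [Subtype.range_coe] at this

end Completeness

/-! ### Precompact groups -/

/-- A topological group is precompact if, for each neighbourhood `U` of the identity, it is covered
by finitely many left translates of `U`. -/
def IsPrecompactGroup (G : Type*) [Group G] [TopologicalSpace G] : Prop :=
  ∀ U ∈ 𝓝 (1 : G), ∃ F : Set G, F.Finite ∧ ∀ x, ∃ y ∈ F, y⁻¹ * x ∈ U

section Precompact

variable {G : Type u} [Group G] [TopologicalSpace G] [IsTopologicalGroup G]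

theorem IsPrecompactGroup.compactSpace (hp : IsPrecompactGroup G) (hc : IsCompleteGroup G) :
    CompactSpace G := by
  have hl : ∀ f : Ultrafilter G, Tendsto (fun p : G × G => p.1⁻¹ * p.2)
      ((f : Filter G) ×ˢ (f : Filter G)) (𝓝 1) := by
    intro f U hU
    obtain ⟨V, hV, h1, hVU⟩ := exists_isOpen_one_inv_mul hU
    obtain ⟨F, hF, hFV⟩ := hp V (hV.mem_nhds h1)
    have : (⋃ y ∈ F, {x | y⁻¹ * x ∈ V}) ∈ f :=
      mem_of_superset univ_mem fun x _ => by simpa using hFV x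
    obtain ⟨y, -, hy⟩ := (Ultrafilter.finite_biUnion_mem_iff hF).1 this
    refine mem_map.2 <| mem_of_superset (prod_mem_prod hy hy) fun p hp => ?_
    have := hVU _ hp.1 _ hp.2
    simpa [mul_assoc] using this
  let _ : UniformSpace G := twoSidedUniformSpace G
  have : CompleteSpace G := hc
  have ht : TotallyBounded (Set.univ : Set G) := by
    refine totallyBounded_iff_ultrafilter.2 fun f _ => ⟨f.neBot, ?_⟩
    rw [twoSidedUniformSpace_uniformity]
    refine le_inf (tendsto_iff_comap.1 (hl f)) (tendsto_iff_comap.1 ?_)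
    -- the right uniformity is the left one transported by inversion
    have h := hl (f.map fun x => x⁻¹)
    rw [Ultrafilter.coe_map, prod_map_map_eq, tendsto_map'_iff] at h
    have h2 := h.inv
    simpa [Function.comp_def] using h2
  exact ⟨isCompact_iff_totallyBounded_isComplete.2 ⟨ht, isComplete_univ⟩⟩

theorem isPrecompactGroup_of_compactSpace [CompactSpace G] : IsPrecompactGroup G := by
  intro U hU
  obtain ⟨t, -, ht⟩ := isCompact_univ.elim_nhds_subcover (fun y : G => {x | y⁻¹ * x ∈ U})
    fun y _ => ContinuousAt.preimage_mem_nhds (f := fun x => y⁻¹ * x) (by fun_prop)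
      (by simpa using hU)
  exact ⟨t, t.finite_toSet, fun x => by simpa using ht (Set.mem_univ x)⟩

/-- The translates of `V` centred outside `L` are replaced by translates of `V⁻¹ * V` centred
in `L`. -/
theorem IsPrecompactGroup.subgroup (h : IsPrecompactGroup G) (L : Subgroup G) :
    IsPrecompactGroup L := by
  classical
  intro U hU
  rw [nhds_induced] at hU
  obtain ⟨U', hU', hU'U⟩ := hU
  obtain ⟨V, hV, h1, hVU⟩ := exists_isOpen_one_inv_mul hU'
  obtain ⟨F, hF, hFV⟩ := h V (hV.mem_nhds h1)
  let c : G → L := fun y => if hy : ∃ z : L, y⁻¹ * (z : G) ∈ V then hy.choose else 1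
  refine ⟨c '' F, hF.image c, fun x => ?_⟩
  obtain ⟨y, hyF, hy⟩ := hFV x
  have hex : ∃ z : L, y⁻¹ * (z : G) ∈ V := ⟨x, hy⟩
  have hc : y⁻¹ * (c y : G) ∈ V := by
    simp only [c, dif_pos hex]
    exact hex.choose_spec
  refine ⟨c y, ⟨y, hyF, rfl⟩, hU'U ?_⟩
  have := hVU _ hc _ hy
  simpa [mul_assoc] using this

theorem IsPrecompactGroup.of_surjective {G K : Type*} [Group G] [TopologicalSpace G] [Group K]
    [TopologicalSpace K] (h : IsPrecompactGroup G) (f : G →* K) (hf : Continuous f)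
    (hs : Function.Surjective f) : IsPrecompactGroup K := by
  intro U hU
  obtain ⟨F, hF, hFU⟩ := h (f ⁻¹' U) (hf.continuousAt.preimage_mem_nhds (by simpa using hU))
  refine ⟨f '' F, hF.image f, fun x => ?_⟩
  obtain ⟨x, rfl⟩ := hs x
  obtain ⟨y, hy, hyx⟩ := hFU x
  exact ⟨f y, ⟨y, hy, rfl⟩, by simpa using hyx⟩

/-- Precompactness is detected on separable closed subgroups, since its failure is witnessed by a
sequence of elements whose left translates of some `V` are pairwise far apart. -/
theorem isPrecompactGroup_of_separable
    (h : ∀ H : Subgroup G, IsClosed (H : Set G) → SeparableSpace H → IsPrecompactGroup H) :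
    IsPrecompactGroup G := by
  intro U hU
  by_contra! hF
  obtain ⟨x, -, hx⟩ := exists_seq_of_forall_finset_exists (fun _ : G => True)
    (fun a b => a⁻¹ * b ∉ U) fun s _ => by
      obtain ⟨b, hb⟩ := hF s s.finite_toSet
      exact ⟨b, trivial, fun a ha => hb a ha⟩
  let S : Subgroup G := (FreeGroup.lift x).range
  let H : Subgroup G := S.topologicalClosure
  have hsep : SeparableSpace H := by
    have : Countable S := (FreeGroup.lift x).rangeRestrict_surjective.countable
    exact (denseRange_inclusion_iff subset_closure).2 subset_rfl |>.separableSpace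
      (continuous_inclusion (subset_closure : (S : Set G) ⊆ _))
  have hxH : ∀ n, x n ∈ H := fun n =>
    S.le_topologicalClosure ⟨FreeGroup.of n, by simp⟩
  obtain ⟨V, hV, h1, hVU⟩ := exists_isOpen_one_inv_mul hU
  obtain ⟨F, hFfin, hFV⟩ := h H S.isClosed_topologicalClosure hsep (Subtype.val ⁻¹' V)
    (continuousAt_subtype_val.preimage_mem_nhds (hV.mem_nhds h1))
  choose y hyF hy using fun n => hFV ⟨x n, hxH n⟩
  have : ∃ m n, m < n ∧ y m = y n := by
    have : Finite F := hFfin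
    obtain ⟨m, n, hmn, he⟩ := Finite.exists_ne_map_eq_of_infinite fun n => (⟨y n, hyF n⟩ : F)
    have he' : y m = y n := congrArg Subtype.val he
    rcases lt_or_gt_of_ne hmn with hlt | hlt
    · exact ⟨m, n, hlt, he'⟩
    · exact ⟨n, m, hlt, he'.symm⟩
  obtain ⟨m, n, hmn, he⟩ := this
  refine hx m n hmn ?_
  have hm : ((y n : H) : G)⁻¹ * x m ∈ V := he ▸ hy m
  have hn : ((y n : H) : G)⁻¹ * x n ∈ V := hy n
  have := hVU _ hm _ hn
  simpa [mul_assoc] using this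

end Precompact

/-! ### The open mapping theorem for Polish groups -/

section OpenMapping

/-- Pettis' lemma: a non-meagre Borel set `A` in a Baire topological group meets all of its
right translates `A * v⁻¹` with `v` close to the identity. -/
theorem MeasurableSet.eventually_exists_mul_mem {K : Type*} [Group K] [TopologicalSpace K]
    [IsTopologicalGroup K] [BaireSpace K] [MeasurableSpace K] [BorelSpace K] {A : Set K}
    (hA : MeasurableSet A) (hm : ¬ IsMeagre A) : ∀ᶠ v in 𝓝 (1 : K), ∃ a ∈ A, a * v ∈ A := by
  obtain ⟨O, hO, hAO⟩ := hA.residualEq_isOpen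
  have hne : O.Nonempty := by
    rw [Set.nonempty_iff_ne_empty]
    rintro rfl
    refine hm ?_
    filter_upwards [hAO] with x hx hxA
    exact hx.mp hxA
  obtain ⟨x, hx⟩ := hne
  have hW : (fun v => x * v) ⁻¹' O ∈ 𝓝 (1 : K) :=
    ContinuousAt.preimage_mem_nhds (by fun_prop) (by simpa using hO.mem_nhds hx)
  filter_upwards [hW] with v hv
  have h1 : {a | a ∈ A ↔ a ∈ O} ∈ residual K := by
    filter_upwards [hAO] with a ha
    exact iff_of_eq ha
  have h2 : {a | a * v ∈ A ↔ a * v ∈ O} ∈ residual K := by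
    have := (Homeomorph.mulRight v).symm.residual_map_eq
    rw [← this]
    refine mem_map.2 ?_
    filter_upwards [h1] with a ha
    change a * v⁻¹ * v ∈ A ↔ a * v⁻¹ * v ∈ O
    simpa using ha
  obtain ⟨y, ⟨hy1, hy2⟩, hy3, hy4⟩ := (dense_of_mem_residual (inter_mem h1 h2)).inter_open_nonempty
    (O ∩ (fun a => a * v) ⁻¹' O) (hO.inter (hO.preimage (by fun_prop))) ⟨x, hx, hv⟩
  exact ⟨y, hy3.2 hy1, hy4.2 hy2⟩

/-- The image of an open set `V` is Borel because its preimage, the union of the translates of `V`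
by the kernel, is; it is not meagre because countably many of its translates cover the target. -/
theorem MonoidHom.isOpenMap_of_polishSpace {L K : Type*} [Group L] [TopologicalSpace L]
    [IsTopologicalGroup L] [PolishSpace L] [Group K] [TopologicalSpace K] [IsTopologicalGroup K]
    [PolishSpace K] (f : L →* K) (hf : Continuous f) (hs : Function.Surjective f) :
    IsOpenMap f := by
  rw [IsTopologicalGroup.isOpenMap_iff_nhds_one]
  intro S hS
  obtain ⟨V, hV, h1, hVS⟩ := exists_isOpen_one_inv_mul hS
  borelize L
  borelize K
  have hpre : f ⁻¹' (f '' V) = ⋃ n ∈ f.ker, (fun x => x * n) ⁻¹' V := by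
    ext x
    simp only [Set.mem_preimage, Set.mem_image, Set.mem_iUnion, exists_prop]
    constructor
    · rintro ⟨y, hy, hyx⟩
      exact ⟨x⁻¹ * y, by simp [MonoidHom.mem_ker, hyx], by simpa using hy⟩
    · rintro ⟨n, hn, hxn⟩
      exact ⟨x * n, hxn, by simp [(MonoidHom.mem_ker).1 hn]⟩
  have hmeas : MeasurableSet (f '' V) := by
    rw [← hf.measurable.measurableSet_preimage_iff_of_surjective hs, hpre]
    exact (isOpen_biUnion fun n _ => hV.preimage (by fun_prop)).measurableSet
  have hnm : ¬ IsMeagre (f '' V) := by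
    intro hm
    refine not_isMeagre_of_isOpen (isOpen_univ (X := K)) Set.univ_nonempty ?_
    have hcov : (Set.univ : Set K) ⊆ ⋃ n, (fun x => (f (denseSeq L n))⁻¹ * x) ⁻¹' (f '' V) := by
      intro y _
      obtain ⟨x, rfl⟩ := hs y
      have hop : IsOpen ((fun d => d⁻¹ * x) ⁻¹' V) := hV.preimage (by fun_prop)
      obtain ⟨n, hn⟩ := (denseRange_denseSeq L).exists_mem_open hop ⟨x, by simpa using h1⟩
      exact Set.mem_iUnion.2 ⟨n, _, hn, by simp⟩
    refine IsMeagre.mono hcov (isMeagre_iUnion fun n => ?_)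
    exact hm.preimage_of_isOpenMap (by fun_prop) (isOpenMap_mul_left _)
  filter_upwards [hmeas.eventually_exists_mul_mem hnm] with v hv
  obtain ⟨_, ⟨a, ha, rfl⟩, b, hb, hbv⟩ := hv
  have : f (a⁻¹ * b) ∈ S := hVS a ha b hb
  simpa [hbv] using this

end OpenMapping

/-! ### Second countable images of separable groups -/

section Guran

/-- The Hausdorff quotient of a separable first countable group is second countable; the
original topology is the one induced from it. -/
theorem exists_monoidHom_comap_nhds_one (H : Type u) [Group H] [TopologicalSpace H]
    [IsTopologicalGroup H] [SeparableSpace H] (h : (𝓝 (1 : H)).IsCountablyGenerated) :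
    ∃ (K : Type u) (_ : Group K) (_ : TopologicalSpace K) (_ : IsTopologicalGroup K)
      (_ : T2Space K) (_ : SecondCountableTopology K) (f : H →* K),
      Function.Surjective f ∧ comap f (𝓝 1) = 𝓝 1 := by
  have : (𝓝 (1 : SeparationQuotient H)).IsCountablyGenerated := by
    rw [← SeparationQuotient.mk_one, ← SeparationQuotient.map_mk_nhds]
    infer_instance
  have hsep : SeparableSpace (SeparationQuotient H) :=
    SeparationQuotient.surjective_mk.denseRange.separableSpace SeparationQuotient.continuous_mk
  have hsc : SecondCountableTopology (SeparationQuotient H) := by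
    let _ : UniformSpace (SeparationQuotient H) := IsTopologicalGroup.rightUniformSpace _
    have : (uniformity (SeparationQuotient H)).IsCountablyGenerated :=
      inferInstanceAs (comap _ (𝓝 (1 : SeparationQuotient H))).IsCountablyGenerated
    exact UniformSpace.secondCountable_of_separable _
  exact ⟨SeparationQuotient H, inferInstance, inferInstance, inferInstance, inferInstance, hsc,
    { toFun := SeparationQuotient.mk, map_one' := rfl, map_mul' := fun _ _ => rfl },
    SeparationQuotient.surjective_mk, SeparationQuotient.comap_mk_nhds_mk⟩

variable {H : Type u} [Group H] [TopologicalSpace H] [IsTopologicalGroup H]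

theorem exists_nhds_one_mul_inv_conj {U W : Set H} (hU : U ∈ 𝓝 (1 : H)) (hW : W ∈ 𝓝 (1 : H))
    (d : ℕ → H) (n : ℕ) : ∃ U' ∈ 𝓝 (1 : H), U' ⊆ U ∧ U' ⊆ W ∧ (∀ a ∈ U', ∀ b ∈ U', a * b ∈ U) ∧
      (∀ a ∈ U', a⁻¹ ∈ U) ∧ ∀ i ≤ n, ∀ a ∈ U', d i * a * (d i)⁻¹ ∈ U := by
  obtain ⟨V, hV, h1, hVU⟩ := exists_open_nhds_one_split hU
  have hc : (⋂ i ∈ Set.Iic n, (fun a => d i * a * (d i)⁻¹) ⁻¹' U) ∈ 𝓝 (1 : H) :=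
    (biInter_mem (Set.finite_Iic n)).2 fun i _ =>
      ContinuousAt.preimage_mem_nhds (by fun_prop) (by simpa using hU)
  refine ⟨U ∩ W ∩ V ∩ U⁻¹ ∩ _, inter_mem (inter_mem (inter_mem (inter_mem hU hW)
    (hV.mem_nhds h1)) (inv_mem_nhds_one H hU)) hc, fun a ha => ha.1.1.1.1, fun a ha => ha.1.1.1.2,
    fun a ha b hb => hVU a ha.1.1.2 b hb.1.1.2, fun a ha => ha.1.2, fun i hi a ha => ?_⟩
  exact Set.mem_iInter₂.1 ha.2 i hi

/-- A separable topological group has enough homomorphisms onto second countable groups. The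
neighbourhoods `U n` are chosen so that conjugation by the first `n` members of a dense sequence
maps `U (n + 1)` into `U n`; by density this extends to conjugation by arbitrary elements, so that
the `U n` form a neighbourhood basis of the identity for a coarser group topology. -/
theorem exists_monoidHom_secondCountable [SeparableSpace H] (W : ℕ → Set H)
    (hW : ∀ n, W n ∈ 𝓝 (1 : H)) :
    ∃ (K : Type u) (_ : Group K) (_ : TopologicalSpace K) (_ : IsTopologicalGroup K)
      (_ : T2Space K) (_ : SecondCountableTopology K) (f : H →* K),
      Continuous f ∧ Function.Surjective f ∧ ∀ n, ∃ V ∈ 𝓝 (1 : K), f ⁻¹' V ⊆ W n := by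
  let d := denseSeq H
  choose next hnext hsub hsubW hmul hinv hconj using
    fun (U : {U : Set H // U ∈ 𝓝 (1 : H)}) (n : ℕ) =>
      exists_nhds_one_mul_inv_conj U.2 (hW n) d n
  let U' : ℕ → {U : Set H // U ∈ 𝓝 (1 : H)} :=
    fun n => Nat.rec ⟨Set.univ, univ_mem⟩ (fun n U => ⟨next U n, hnext U n⟩) n
  let U : ℕ → Set H := fun n => (U' n).1
  have hU : ∀ n, U n ∈ 𝓝 (1 : H) := fun n => (U' n).2
  have hUanti : Antitone U := antitone_nat_of_succ_le fun n => hsub (U' n) n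
  have hUW : ∀ n, U (n + 1) ⊆ W n := fun n => hsubW (U' n) n
  have hUmul : ∀ n, ∀ a ∈ U (n + 1), ∀ b ∈ U (n + 1), a * b ∈ U n := fun n => hmul (U' n) n
  have hUinv : ∀ n, ∀ a ∈ U (n + 1), a⁻¹ ∈ U n := fun n => hinv (U' n) n
  have hUconj : ∀ n, ∀ i ≤ n, ∀ a ∈ U (n + 1), d i * a * (d i)⁻¹ ∈ U n :=
    fun n => hconj (U' n) n
  let B : GroupFilterBasis H :=
    { sets := Set.range U
      nonempty := ⟨_, 0, rfl⟩
      inter_sets := by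
        rintro _ _ ⟨m, rfl⟩ ⟨n, rfl⟩
        exact ⟨_, ⟨max m n, rfl⟩, Set.subset_inter (hUanti (le_max_left m n))
          (hUanti (le_max_right m n))⟩
      one' := by
        rintro _ ⟨n, rfl⟩
        exact mem_of_mem_nhds (hU n)
      mul' := by
        rintro _ ⟨n, rfl⟩
        refine ⟨_, ⟨n + 1, rfl⟩, ?_⟩
        rintro _ ⟨a, ha, b, hb, rfl⟩
        exact hUmul n a ha b hb
      inv' := by
        rintro _ ⟨n, rfl⟩
        exact ⟨_, ⟨n + 1, rfl⟩, hUinv n⟩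
      conj' := by
        rintro x _ ⟨n, rfl⟩
        have hx : (fun y => x * y⁻¹) ⁻¹' U (n + 3) ∈ 𝓝 x :=
          ContinuousAt.preimage_mem_nhds (by fun_prop) (by simpa using hU (n + 3))
        obtain ⟨_, hi, i, rfl⟩ := mem_closure_iff_nhds.1 (denseRange_denseSeq H x) _ hx
        refine ⟨_, ⟨max (n + 2) i + 1, rfl⟩, fun a ha => ?_⟩
        -- conjugate by `d i` first, then by the small element `x * (d i)⁻¹`
        have h1 := hUanti (le_max_left (n + 2) i) (hUconj _ i (le_max_right _ _) a ha)
        have hi' : x * (d i)⁻¹ ∈ U (n + 3) := hi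
        have h2 := hUmul (n + 1) _ (hUanti (Nat.le_succ (n + 2)) hi') _ h1
        have h3 := hUmul n _ h2 _ (hUanti (Nat.le_succ (n + 1)) (hUinv (n + 2) _ hi'))
        simpa [mul_assoc, d] using h3 }
  -- two topologies on `H` are in play: the given one and the coarser one defined by `B`
  have hB : ∀ n, U n ∈ @nhds H B.topology 1 := fun n => B.mem_nhds_one ⟨n, rfl⟩
  have hle : 𝓝 (1 : H) ≤ @nhds H B.topology 1 := by
    intro S hS
    obtain ⟨_, ⟨n, rfl⟩, hn⟩ := B.nhds_one_hasBasis.mem_iff.1 hS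
    exact mem_of_superset (hU n) hn
  have hcg : (@nhds H B.topology 1).IsCountablyGenerated := by
    rw [B.nhds_one_eq]
    refine HasCountableBasis.isCountablyGenerated
      ⟨B.toFilterBasis.hasBasis, Set.countable_range U⟩
  have hid : @Continuous H H _ B.topology (MonoidHom.id H) :=
    @continuous_of_continuousAt_one H _ _ _ H (H →* H) _ B.topology
      B.isTopologicalGroup.toContinuousMul _ _ (MonoidHom.id H) hle
  have hsep : @SeparableSpace H B.topology :=
    @DenseRange.separableSpace H H _ _ B.topology _
      (@Function.Surjective.denseRange H B.topology H _ Function.surjective_id) hid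
  obtain ⟨K, _, _, _, _, _, f, hs, hf⟩ :=
    @exists_monoidHom_comap_nhds_one H _ B.topology B.isTopologicalGroup hsep hcg
  refine ⟨K, _, _, inferInstance, inferInstance, inferInstance, f,
    continuous_of_continuousAt_one f ?_, hs, fun n => ?_⟩
  · rw [ContinuousAt, map_one, tendsto_iff_comap, hf]
    exact hle
  · have := hB (n + 1)
    rw [← hf] at this
    obtain ⟨V, hV, hVU⟩ := this
    exact ⟨V, hV, hVU.trans (hUW n)⟩

end Guran

/-! ### Sequentially `h`-complete groups -/

section SeqHComplete

variable {H : Type u} [Group H] [TopologicalSpace H] [IsTopologicalGroup H]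

theorem IsSeqHComplete.of_surjective (hH : IsSeqHComplete H) {K : Type u} [Group K]
    [TopologicalSpace K] [IsTopologicalGroup K] (f : H →* K) (hf : Continuous f)
    (hs : Function.Surjective f) : IsSeqHComplete K :=
  fun L _ _ _ _ g hg hgs => hH L (g.comp f) (hg.comp hf) (hgs.comp hs)

theorem IsHComplete.isSeqHComplete (hH : IsHComplete H) : IsSeqHComplete H :=
  fun K _ _ _ _ f hf hs => (hH K f hf hs).isSeqCompleteGroup

theorem IsHComplete.of_surjective (hH : IsHComplete H) {K : Type u} [Group K]
    [TopologicalSpace K] [IsTopologicalGroup K] (f : H →* K) (hf : Continuous f)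
    (hs : Function.Surjective f) : IsHComplete K :=
  fun L _ _ _ _ g hg hgs => hH L (g.comp f) (hg.comp hf) (hgs.comp hs)

theorem IsMAP.of_injective {K : Type u} [Group K] [TopologicalSpace K] [IsTopologicalGroup K]
    (hK : IsMAP K) (f : H →* K) (hf : Continuous f) (hi : Function.Injective f) : IsMAP H := by
  obtain ⟨C, _, _, _, _, _, m, hm, hmi⟩ := hK
  exact ⟨C, _, _, inferInstance, inferInstance, inferInstance, m.comp f, hm.comp hf, hmi.comp hi⟩

theorem isMAP_of_compactSpace [CompactSpace H] [T2Space H] : IsMAP H :=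
  ⟨H, _, _, inferInstance, inferInstance, inferInstance, MonoidHom.id H, continuous_id,
    Function.injective_id⟩

theorem isHComplete_of_compactSpace [CompactSpace H] : IsHComplete H := by
  intro K _ _ _ _ f hf hs
  have : CompactSpace K := hs.compactSpace hf
  exact isCompleteGroup_of_compactSpace

/-- For a neighbourhood `U` of the identity, a homomorphism `g` onto a second countable group that
is fine enough to see `U` reduces the claim to the open mapping theorem for the first projection of
the image of `(f, g)`, which is a Polish group. -/
theorem IsSeqHComplete.isOpenMap [SeparableSpace H] (hH : IsSeqHComplete H) {K : Type u} [Group K]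
    [TopologicalSpace K] [IsTopologicalGroup K] [T2Space K] [SecondCountableTopology K]
    (f : H →* K) (hf : Continuous f) (hs : Function.Surjective f) : IsOpenMap f := by
  rw [IsTopologicalGroup.isOpenMap_iff_nhds_one]
  intro S hS
  obtain ⟨Q, _, _, _, _, _, g, hg, -, hV⟩ :=
    exists_monoidHom_secondCountable (fun _ => f ⁻¹' S) fun _ => hS
  obtain ⟨V, hV, hVS⟩ := hV 0
  let L : Subgroup (K × Q) := (f.prod g).range
  have : SecondCountableTopology L := Topology.IsEmbedding.subtypeVal.secondCountableTopology
  have hL : PolishSpace L := (hH L (f.prod g).rangeRestrict ((hf.prodMk hg).subtype_mk _)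
    (f.prod g).rangeRestrict_surjective).polishSpace
  have hK : PolishSpace K := (hH K f hf hs).polishSpace
  let p : L →* K := (MonoidHom.fst K Q).comp L.subtype
  have hp : IsOpenMap p := p.isOpenMap_of_polishSpace
    (continuous_fst.comp continuous_subtype_val) fun x => by
      obtain ⟨y, rfl⟩ := hs x
      exact ⟨⟨_, y, rfl⟩, rfl⟩
  have hN : {z : L | z.1.2 ∈ V} ∈ 𝓝 (1 : L) :=
    (continuous_snd.comp continuous_subtype_val).continuousAt.preimage_mem_nhds hV
  have := hp.image_mem_nhds hN
  rw [map_one] at this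
  refine mem_of_superset this ?_
  rintro _ ⟨⟨_, y, rfl⟩, hy, rfl⟩
  exact hVS hy

theorem compactSpace_of_isOpenMap_of_bijective {X Y : Type*} [TopologicalSpace X]
    [TopologicalSpace Y] [CompactSpace Y] {f : X → Y} (hc : Continuous f) (ho : IsOpenMap f)
    (hb : Function.Bijective f) : CompactSpace X :=
  ((IsHomeomorph.mk hc ho hb).homeomorph f).symm.compactSpace

/-- An injection into a compact group is separated from the identity by countably many
neighbourhoods of the identity, and hence refines to a bijection onto a second countable precompact
group. That group is complete, hence compact, and the bijection is open. -/
theorem IsSeqHComplete.compactSpace_of_isMAP [SecondCountableTopology H] (hH : IsSeqHComplete H)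
    (hm : IsMAP H) : CompactSpace H := by
  obtain ⟨C, _, _, _, _, _, m, hm, hmi⟩ := hm
  have hsep : ∀ x : H, ∃ u ∈ 𝓝 x, ∃ v ∈ 𝓝 (1 : C), x ≠ 1 → ∀ y ∈ u, m y ∉ v := by
    intro x
    by_cases hx : x = 1
    · exact ⟨_, univ_mem, _, univ_mem, fun h => absurd hx h⟩
    · have : m x ≠ 1 := fun h => hx (hmi (h.trans m.map_one.symm))
      obtain ⟨u, v, hu, hv, hxu, h1v, huv⟩ := t2_separation this
      exact ⟨m ⁻¹' u, hm.continuousAt.preimage_mem_nhds (hu.mem_nhds hxu), v, hv.mem_nhds h1v,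
        fun _ y hy hyv => huv.le_bot ⟨hy, hyv⟩⟩
  choose u hu v hv huv using hsep
  obtain ⟨t, ht1, htc, ht⟩ := countable_cover_nhdsWithin (s := {(1 : H)}ᶜ) (f := u)
    fun x _ => mem_nhdsWithin_of_mem_nhds (hu x)
  obtain ⟨e, he⟩ := Set.countable_iff_exists_subset_range.1 htc
  let P : Subgroup C := m.range
  have hPc : Continuous m.rangeRestrict := hm.subtype_mk _
  have : SeparableSpace P :=
    m.rangeRestrict_surjective.denseRange.separableSpace hPc
  obtain ⟨Q, _, _, _, _, _, g, hg, hgs, hV⟩ := exists_monoidHom_secondCountable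
    (fun n => ((↑) : P → C) ⁻¹' v (e n))
    fun n => continuousAt_subtype_val.preimage_mem_nhds (hv (e n))
  let f : H →* Q := g.comp m.rangeRestrict
  have hf : Continuous f := hg.comp hPc
  have hfs : Function.Surjective f := hgs.comp m.rangeRestrict_surjective
  have hfi : Function.Injective f := by
    refine (injective_iff_map_eq_one f).2 fun x hx => ?_
    by_contra hx1
    obtain ⟨y, hyt, hxy⟩ := Set.mem_iUnion₂.1 (ht hx1)
    obtain ⟨n, rfl⟩ := he hyt
    obtain ⟨V, hV, hVe⟩ := hV n
    refine huv (e n) (ht1 hyt) x hxy (hVe (a := m.rangeRestrict x) ?_)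
    change f x ∈ V
    exact hx ▸ mem_of_mem_nhds hV
  have hpre : IsPrecompactGroup Q :=
    (isPrecompactGroup_of_compactSpace.subgroup P).of_surjective g hg hgs
  have : CompactSpace Q := hpre.compactSpace (hH Q f hf hfs).isCompleteGroup
  exact compactSpace_of_isOpenMap_of_bijective hf (hH.isOpenMap f hf hfs) ⟨hfi, hfs⟩

/-- By openness, a second countable image of `H` is a metrizable quotient, hence maximally almost
periodic, hence compact; and such images determine the neighbourhoods of the identity of `H`. -/
theorem IsSeqHComplete.isPrecompactGroup [SeparableSpace H] (hH : IsSeqHComplete H)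
    (hm : ∀ (N : Subgroup H) [N.Normal], MetrizableSpace (H ⧸ N) → IsMAP (H ⧸ N)) :
    IsPrecompactGroup H := by
  intro U hU
  obtain ⟨K, _, _, _, _, _, f, hf, hs, hV⟩ :=
    exists_monoidHom_secondCountable (fun _ => U) fun _ => hU
  obtain ⟨V, hV, hVU⟩ := hV 0
  let e : H ⧸ f.ker ≃* K := QuotientGroup.quotientKerEquivOfSurjective f hs
  have hec : Continuous e := (QuotientGroup.isQuotientMap_mk _).continuous_iff.2 hf
  have heo : IsOpenMap e :=
    IsOpenMap.of_comp QuotientGroup.continuous_mk QuotientGroup.mk_surjective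
      (hH.isOpenMap f hf hs)
  let E : H ⧸ f.ker ≃ₜ K := e.toEquiv.toHomeomorphOfContinuousOpen hec heo
  have : PolishSpace K := (hH K f hf hs).polishSpace
  have hMAP : IsMAP K := (hm f.ker E.isEmbedding.metrizableSpace).of_injective
    e.symm.toMonoidHom E.symm.continuous e.symm.injective
  have : CompactSpace K := (hH.of_surjective f hf hs).compactSpace_of_isMAP hMAP
  obtain ⟨F, hF, hFV⟩ := isPrecompactGroup_of_compactSpace (G := K) V hV
  choose c hc using id hs
  refine ⟨c '' F, hF.image c, fun x => ?_⟩
  obtain ⟨y, hy, hyx⟩ := hFV (f x)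
  exact ⟨c y, ⟨y, hy, rfl⟩, hVU (by simpa [hc] using hyx)⟩

/-- An injection `m` of `H` into a compact group has complete, hence closed, images of `H` and `N`,
and induces an injection of `H ⧸ N` into the compact group `m(H) / m(N)`. -/
theorem IsHComplete.isMAP_quotient (hH : IsHComplete H) (hm : IsMAP H) (N : Subgroup H) [N.Normal]
    (hN : IsHComplete N) : IsMAP (H ⧸ N) := by
  obtain ⟨C, _, _, _, _, _, m, hm, hmi⟩ := hm
  let M : Subgroup C := m.range
  let φ : H →* M := m.rangeRestrict
  have hφ : Continuous φ := hm.subtype_mk _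
  have hφs : Function.Surjective φ := m.rangeRestrict_surjective
  have hφi : Function.Injective φ := m.rangeRestrict_injective_iff.2 hmi
  have hM : CompactSpace M :=
    isCompact_iff_compactSpace.1 (M.isClosed_of_isCompleteGroup (hH M φ hφ hφs)).isCompact
  let N' : Subgroup M := N.map φ
  have : N'.Normal := Subgroup.Normal.map inferInstance φ hφs
  have hN' : IsClosed (N' : Set M) := N'.isClosed_of_isCompleteGroup <|
    hN N' (φ.subgroupMap N) ((hφ.comp continuous_subtype_val).subtype_mk _)
      (φ.subgroupMap_surjective N)
  refine ⟨M ⧸ N', inferInstance, inferInstance, inferInstance, inferInstance, inferInstance,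
    QuotientGroup.map N N' φ (Subgroup.le_comap_map φ N), ?_, ?_⟩
  · exact (QuotientGroup.isQuotientMap_mk _).continuous_iff.2
      (QuotientGroup.continuous_mk.comp hφ)
  · rw [injective_iff_map_eq_one]
    intro x hx
    obtain ⟨x, rfl⟩ := QuotientGroup.mk_surjective x
    have hx' : φ x ∈ N' := (QuotientGroup.eq_one_iff _).1 hx
    exact (QuotientGroup.eq_one_iff x).2 ((Subgroup.mem_map_iff_mem hφi).1 hx')

end SeqHComplete

/-! ### Compactness of complete groups -/

theorem mainTheorem1 (G : Type u) [Group G] [TopologicalSpace G] [IsTopologicalGroup G]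
    [T2Space G] (hG : IsCompleteGroup G) :
    List.TFAE
      [∀ H : Subgroup G, IsClosed (H : Set G) → TopologicalSpace.SeparableSpace H →
          ∀ N : Subgroup H, N.Normal → IsClosed (N : Set H) → IsHComplete N ∧ IsMAP N,
        ∀ H : Subgroup G, IsClosed (H : Set G) → TopologicalSpace.SeparableSpace H →
          IsSeqHComplete H ∧
            ∀ (N : Subgroup H) [N.Normal],
              TopologicalSpace.MetrizableSpace (H ⧸ N) → IsMAP (H ⧸ N),
        CompactSpace G] := by
  tfae_have 1 → 2 := by
    intro h H hH hsep
    have htop := h H hH hsep ⊤ inferInstance isClosed_univ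
    have hHc : IsHComplete H := htop.1.of_surjective (⊤ : Subgroup H).subtype
      continuous_subtype_val fun x => ⟨⟨x, trivial⟩, rfl⟩
    have hHm : IsMAP H := htop.2.of_injective
      (Subgroup.topEquiv (G := H)).symm.toMonoidHom (continuous_id.subtype_mk _)
      Subgroup.topEquiv.symm.injective
    refine ⟨hHc.isSeqHComplete, fun N _ hN => ?_⟩
    have hNc : IsClosed (N : Set H) := QuotientGroup.t1Space_iff.1 inferInstance
    exact hHc.isMAP_quotient hHm N (h H hH hsep N inferInstance hNc).1
  tfae_have 2 → 3 := by
    intro h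
    refine IsPrecompactGroup.compactSpace (isPrecompactGroup_of_separable fun H hH hsep => ?_) hG
    exact (h H hH hsep).1.isPrecompactGroup (h H hH hsep).2
  tfae_have 3 → 1 := by
    intro _ H hH _ N _ hN
    have : CompactSpace H := isCompact_iff_compactSpace.1 hH.isCompact
    have : CompactSpace N := isCompact_iff_compactSpace.1 hN.isCompact
    exact ⟨isHComplete_of_compactSpace, isMAP_of_compactSpace⟩
  tfae_finish
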